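/- Let $n,m\ge 0$ be integers. Write a polynomial $f\in\mathbb{R}[x_1,\dots,x_n]$ of degree at most $2$ as $f(x)=x^TAx+2a^Tx+\alpha$ with $A\in\mathrm{Sym}_n(\mathbb{R})$, $a\in\mathbb{R}^n$, $\alpha\in\mathbb{R}$. For a list $F=(f_1,\dots,f_m)$ of such polynomials, $f_i(x)=x^TA_ix+2a_i^Tx+\alpha_i$, let $\mathcal{I}(F)$ be the ideal generated by $f_1,\dots,f_m$ in $\mathbb{R}[x_1,\dots,x_n]$, let $\mathcal{V}_{\mathbb{R}}(F)=\{x\in\mathbb{R}^n: f_1(x)=\dots=f_m(x)=0\}$, and let the SDP exact region of $F$ be $$\mathcal{R}_F=\Big\{(C,c)\in \mathrm{Sym}_n(\mathbb{R})\times\mathbb{R}^n:\ H(\lambda)\succ 0,\ c-\sum_{i=1}^m\lambda_ia_i+H(\lambda)x=0\ \text{for some } x\in\mathcal{V}_{\mathbb{R}}(F),\ \lambda\in\mathbb{R}^m\Big\},$$ where $H(\lambda)=C-\sum_{i=1}^m\lambda_iA_i$. Then there is a dense, Zariski open subset $U$ (depending only on $n$ and $m$) of the real affine space of all coefficient vectors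 of lists of $m$ polynomials of degree at most $2$ in $n$ variables, with the following property. Let $F=(f_1,\dots,f_m)$ be a list of polynomials with $\deg(f_i)=2$ for all $i$, such that every monomial of degree at most $2$ occurs in every $f_i$ with nonzero coefficient, and such that the coefficient vector of $F$ lies in $U$. Then $\mathcal{R}_F$ is invariant under the choice of generators of $\mathcal{I}(F)$: for every $N\ge 0$ and every list $G=(g_1,\dots,g_N)$ of polynomials of degree at most $2$ in $\mathbb{R}[x_1,\dots,x_n]$ with $\mathcal{I}(G)=\mathcal{I}(F)$, one has $\mathcal{R}_G=\mathcal{R}_F$. -/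

import Mathlib

open MvPolynomial

noncomputable section

namespace ShorSDP

/-- The symmetric matrix `A` of the quadratic part of a polynomial
`f = xᵀ A x + 2 aᵀ x + α` of degree at most two. -/
def quadMatrix {n : ℕ} (f : MvPolynomial (Fin n) ℝ) : Matrix (Fin n) (Fin n) ℝ :=
  Matrix.of fun j k =>
    if j = k then coeff (Finsupp.single j 2) f
    else coeff (Finsupp.single j 1 + Finsupp.single k 1) f / 2

/-- The vector `a` of a polynomial `f = xᵀ A x + 2 aᵀ x + α` of degree at most two. -/
def linVector {n : ℕ} (f : MvPolynomial (Fin n) ℝ) : Fin n → ℝ :=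
  fun j => coeff (Finsupp.single j 1) f / 2

/-- The real variety of a list of polynomials. -/
def realVariety {n m : ℕ} (F : Fin m → MvPolynomial (Fin n) ℝ) : Set (Fin n → ℝ) :=
  {x | ∀ i, eval x (F i) = 0}

/-- Half the Hessian of the Lagrangian, `H(μ) = C - ∑ i, μ i • A_i`. -/
def hessian {n m : ℕ} (F : Fin m → MvPolynomial (Fin n) ℝ)
    (C : Matrix (Fin n) (Fin n) ℝ) (μ : Fin m → ℝ) : Matrix (Fin n) (Fin n) ℝ :=
  C - ∑ i, μ i • quadMatrix (F i)

/-- The SDP exact region `R_F` of a list `F` of polynomials of degree at most two: the objective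
functions `xᵀ C x + 2 cᵀ x`, with `C` symmetric, such that `H(μ) ≻ 0` and
`c - ∑ i, μ i • a_i + H(μ) x = 0` for some real zero `x` of `F` and some multiplier `μ`. -/
def exactRegion {n m : ℕ} (F : Fin m → MvPolynomial (Fin n) ℝ) :
    Set (Matrix (Fin n) (Fin n) ℝ × (Fin n → ℝ)) :=
  {p | p.1.IsSymm ∧ ∃ x ∈ realVariety F, ∃ μ : Fin m → ℝ,
    (hessian F p.1 μ).PosDef ∧
      p.2 - ∑ i, μ i • linVector (F i) + (hessian F p.1 μ).mulVec x = 0}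

/-- The ideal generated by a list of polynomials. -/
def idealOf {n m : ℕ} (F : Fin m → MvPolynomial (Fin n) ℝ) : Ideal (MvPolynomial (Fin n) ℝ) :=
  Ideal.span (Set.range F)

/-- `R_F` is invariant under the choice of generators of the ideal of `F`: every finite list `G`
of polynomials of degree at most two that generates the same ideal has the same SDP exact region. -/
def InvariantUnderGenerators {n m : ℕ} (F : Fin m → MvPolynomial (Fin n) ℝ) : Prop :=
  ∀ (N : ℕ) (G : Fin N → MvPolynomial (Fin n) ℝ),
    (∀ t, (G t).totalDegree ≤ 2) → idealOf G = idealOf F → exactRegion G = exactRegion F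

/-- Exponents of the monomials of degree at most two in `n` variables. -/
abbrev QuadExponent (n : ℕ) : Type := {s : Fin n →₀ ℕ // s.degree ≤ 2}

/-- The vector of all coefficients of a list of polynomials of degree at most two. -/
def coeffVector {n m : ℕ} (F : Fin m → MvPolynomial (Fin n) ℝ) : Fin m × QuadExponent n → ℝ :=
  fun p => coeff p.2.1 (F p.1)

/-- Every monomial of degree at most two occurs in `f`. -/
def FullMonomialSupport {n : ℕ} (f : MvPolynomial (Fin n) ℝ) : Prop :=
  ∀ s : QuadExponent n, coeff s.1 f ≠ 0

/-- A subset of a real affine space is Zariski open if its complement is the set of common zeros of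
an ideal of polynomials. -/
def IsZariskiOpen {ι : Type*} (U : Set (ι → ℝ)) : Prop :=
  ∃ I : Ideal (MvPolynomial ι ℝ), Uᶜ = zeroLocus ℝ I

end ShorSDP

end

noncomputable section

namespace ShorSDP

/-! ### Substituting `f i` for `X i ^ 2`. -/

section SquareSubstitution

variable {σ R : Type*} [CommRing R]

/-! The region depends on a list only through its real variety and its linear span, since
multipliers enter only through combinations `∑ i, μ i • F i`. So it suffices that generating the
same ideal forces equal spans, or that the variety is empty.

If `m ≤ n`, pad the list with squares of variables to `f` and let `T = squareSubst f`. Generically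
`T` is bijective on polynomials of degree at most `d` for every `d`: `R[x]` is free over `R[f]` on
the squarefree monomials, compatibly with degree. A relation `g = ∑ c_t G_t` in degree at most 2
pulls back along `T` to `∑ Q_t k_t` with quadratic forms `Q_t`. Degrees leave only the constant
terms of the `k_t`, so `g` lies in the linear span (`mem_span_of_mem_ideal_of_compatibleForms`).

If `m > n`, generically 1 is a combination of multiples of `n + 1` of the polynomials, so the
variety and both regions are empty.

Each genericity condition is the nonvanishing of a determinant in the coefficients, equal to 1 at a
list built from squares of variables. -/

theorem totalDegree_le_iff_degree {p : MvPolynomial σ R} {d : ℕ} :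
    p.totalDegree ≤ d ↔ ∀ s : σ →₀ ℕ, coeff s p ≠ 0 → s.degree ≤ d := by
  simp only [totalDegree, Finset.sup_le_iff, mem_support_iff]
  rfl

theorem totalDegree_monomial_le_degree (s : σ →₀ ℕ) (r : R) :
    (monomial s r).totalDegree ≤ s.degree := totalDegree_monomial_le s r

/-- Every nonconstant term of `k` pushes `Q` beyond degree `d`. -/
theorem coeff_mul_of_isHomogeneous {Q k : MvPolynomial σ R} {d : ℕ} (hQ : Q.IsHomogeneous d)
    {s : σ →₀ ℕ} (hs : s.degree ≤ d) : coeff s (Q * k) = coeff 0 k * coeff s Q := by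
  classical
  rw [coeff_mul, Finset.sum_eq_single (s, 0), mul_comm]
  · rintro ⟨a, b⟩ hab hne
    rw [Finset.HasAntidiagonal.mem_antidiagonal] at hab
    by_contra h
    have ha : a.degree = d := by
      by_contra had
      exact h (by rw [hQ.coeff_eq_zero had, zero_mul])
    have hb : b = 0 := by
      rw [← Finsupp.degree_eq_zero_iff]
      have := congrArg Finsupp.degree hab
      simp only [map_add] at this
      omega
    subst hb
    simp only [add_zero] at hab
    exact hne (by rw [← hab])
  · simp

variable [Fintype σ]

/-- The polynomial obtained from the monomial `X ^ c` by writing it as `X ^ e * (X ^ a) ^ 2` with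
`e` squarefree and replacing each square `X i ^ 2` by `f i`. -/
def squareFamily (f : σ → MvPolynomial σ R) (c : σ →₀ ℕ) : MvPolynomial σ R :=
  ∏ i, (X i ^ (c i % 2) * f i ^ (c i / 2))

/-- The linear endomorphism replacing the square `X i ^ 2` by `f i` in every monomial. -/
def squareSubst (f : σ → MvPolynomial σ R) : MvPolynomial σ R →ₗ[R] MvPolynomial σ R :=
  (basisMonomials σ R).constr R (squareFamily f)

theorem squareSubst_monomial (f : σ → MvPolynomial σ R) (c : σ →₀ ℕ) :
    squareSubst f (monomial c 1) = squareFamily f c := by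
  have := (basisMonomials σ R).constr_basis R (squareFamily f) c
  rwa [coe_basisMonomials] at this

theorem squareFamily_two_smul_add (f : σ → MvPolynomial σ R) (a c : σ →₀ ℕ) :
    squareFamily f (2 • a + c) = (∏ i, f i ^ a i) * squareFamily f c := by
  unfold squareFamily
  rw [← Finset.prod_mul_distrib]
  refine Finset.prod_congr rfl fun i _ => ?_
  have h1 : (2 • a + c) i % 2 = c i % 2 := by simp
  have h2 : (2 • a + c) i / 2 = a i + c i / 2 := by
    simp only [Finsupp.add_apply, Finsupp.smul_apply, smul_eq_mul]; omega
  rw [h1, h2, pow_add]; ring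

/-- Even exponents do not affect parities, so multiplying by squares of variables becomes
multiplying by the `f i`. -/
theorem squareSubst_two_smul_mul (f : σ → MvPolynomial σ R) (a : σ →₀ ℕ) (h : MvPolynomial σ R) :
    squareSubst f (monomial (2 • a) 1 * h) = (∏ i, f i ^ a i) * squareSubst f h := by
  have : squareSubst f ∘ₗ LinearMap.mulLeft R (monomial (2 • a) 1) =
      LinearMap.mulLeft R (∏ i, f i ^ a i) ∘ₗ squareSubst f := by
    refine (basisMonomials σ R).ext fun c => ?_
    simp [coe_basisMonomials, monomial_mul, squareSubst_monomial, squareFamily_two_smul_add]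
  exact LinearMap.congr_fun this h

theorem squareSubst_sq_mul (f : σ → MvPolynomial σ R) (j : σ) (h : MvPolynomial σ R) :
    squareSubst f (X j ^ 2 * h) = f j * squareSubst f h := by
  classical
  have := squareSubst_two_smul_mul f (Finsupp.single j 1) h
  rw [Finset.prod_eq_single j (by intro b _ hb; simp [hb.symm]) (by simp)]
    at this
  rw [X_pow_eq_monomial]
  simpa using this

theorem totalDegree_squareFamily_le {f : σ → MvPolynomial σ R} (hf : ∀ i, (f i).totalDegree ≤ 2)
    (c : σ →₀ ℕ) : (squareFamily f c).totalDegree ≤ c.degree := by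
  cases subsingleton_or_nontrivial R
  · rw [Subsingleton.elim (squareFamily f c) 0]; simp
  refine (totalDegree_finsetProd _ _).trans ?_
  rw [Finsupp.degree_eq_sum]
  refine Finset.sum_le_sum fun i _ => (totalDegree_mul _ _).trans ?_
  rw [totalDegree_X_pow]
  have h1 := (totalDegree_pow (f i) (c i / 2)).trans (Nat.mul_le_mul_left _ (hf i))
  omega

theorem totalDegree_squareSubst_le {f : σ → MvPolynomial σ R} (hf : ∀ i, (f i).totalDegree ≤ 2)
    {p : MvPolynomial σ R} {d : ℕ} (hp : p.totalDegree ≤ d) :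
    (squareSubst f p).totalDegree ≤ d := by
  rw [as_sum p, map_sum]
  refine totalDegree_finsetSum_le fun s hs => ?_
  have : monomial s (coeff s p) = coeff s p • monomial s 1 := by simp [smul_monomial]
  rw [this, map_smul, squareSubst_monomial]
  exact (totalDegree_smul_le _ _).trans ((totalDegree_squareFamily_le hf s).trans
    (totalDegree_le_iff_degree.1 hp s (mem_support_iff.1 hs)))

theorem squareFamily_sq (c : σ →₀ ℕ) :
    squareFamily (fun i => (X i : MvPolynomial σ R) ^ 2) c = monomial c 1 := by
  rw [monomial_eq, C_1, one_mul, Finsupp.prod_fintype _ _ (by simp)]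
  refine Finset.prod_congr rfl fun i _ => ?_
  rw [← pow_mul, ← pow_add, Nat.mod_add_div]

theorem map_squareFamily {S : Type*} [CommRing S] (φ : R →+* S) (f : σ → MvPolynomial σ R)
    (c : σ →₀ ℕ) : map φ (squareFamily f c) = squareFamily (fun i => map φ (f i)) c := by
  simp [squareFamily]

/-- If every polynomial of small degree is the image under `squareSubst f` of one of no larger
degree, then so is every monomial. -/
theorem monomial_mem_map_squareSubst {f : σ → MvPolynomial σ R}
    (hsurj : ∀ d ≤ Fintype.card σ + 1,
      restrictTotalDegree σ R d ≤ (restrictTotalDegree σ R d).map (squareSubst f))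
    (c : σ →₀ ℕ) :
    monomial c (1 : R) ∈ (restrictTotalDegree σ R c.degree).map (squareSubst f) := by
  classical
  -- Split `c = 2a + e` with `e` squarefree. Since `squareSubst f` fixes `X ^ e`, only `X j * X ^ e`
  -- needs a preimage; its degree is at most `card σ + 1`, whence the bound in `hsurj`.
  have hmul : ∀ (j : σ) (c : σ →₀ ℕ), X j * squareFamily f c ∈
      (restrictTotalDegree σ R (c.degree + 1)).map (squareSubst f) := by
    intro j c
    set a : σ →₀ ℕ := Finsupp.equivFunOnFinite.symm fun i => c i / 2 with ha
    set e : σ →₀ ℕ := Finsupp.equivFunOnFinite.symm fun i => c i % 2 with he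
    have hc : c = 2 • a + e := by
      ext i; simp [ha, he, Nat.div_add_mod]
    have hdeg : e.degree ≤ Fintype.card σ := by
      rw [Finsupp.degree_eq_sum]
      calc ∑ i, e i ≤ ∑ _i : σ, 1 :=
            Finset.sum_le_sum fun i _ => by
              simp only [he, Finsupp.equivFunOnFinite_symm_apply_apply]; omega
        _ = Fintype.card σ := by simp
    have hfe : squareFamily f e = monomial e 1 := by
      rw [monomial_eq, C_1, one_mul, Finsupp.prod_fintype _ _ (by simp)]
      refine Finset.prod_congr rfl fun i _ => ?_
      have h1 : e i % 2 = e i := by simp [he]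
      have h2 : e i / 2 = 0 := by simp [he]
      rw [h1, h2, pow_zero, mul_one]
    have hX : X j * monomial e (1 : R) ∈ restrictTotalDegree σ R (e.degree + 1) := by
      rw [mem_restrictTotalDegree, X, monomial_mul]
      refine (totalDegree_monomial_le_degree _ _).trans ?_
      rw [map_add, Finsupp.degree_single]; omega
    obtain ⟨h, hh, hTh⟩ := hsurj _ (by omega) hX
    refine ⟨monomial (2 • a) 1 * h, ?_, ?_⟩
    · simp only [SetLike.mem_coe, mem_restrictTotalDegree] at hh ⊢
      refine (totalDegree_mul _ _).trans ?_
      have h1 := totalDegree_monomial_le_degree (2 • a) (1 : R)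
      rw [hc, map_add]
      omega
    · rw [squareSubst_two_smul_mul, hTh]
      conv_rhs => rw [hc, squareFamily_two_smul_add, hfe]
      ring
  induction hn : c.degree generalizing c with
  | zero =>
    rw [Finsupp.degree_eq_zero_iff] at hn
    subst hn
    refine ⟨monomial 0 1, ?_, ?_⟩
    · simp [mem_restrictTotalDegree]
    · rw [squareSubst_monomial]; simp [squareFamily]
  | succ d ih =>
    obtain ⟨j, hj⟩ : ∃ j, c j ≠ 0 := by
      by_contra! h
      rw [Finsupp.degree_eq_sum] at hn
      simp [h] at hn
    have hc : c = Finsupp.single j 1 + (c - Finsupp.single j 1) :=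
      (add_tsub_cancel_of_le (Finsupp.single_le_iff.2 (Nat.one_le_iff_ne_zero.2 hj))).symm
    have hd : (c - Finsupp.single j 1).degree = d := by
      have := congrArg Finsupp.degree hc
      rw [map_add, Finsupp.degree_single] at this
      omega
    obtain ⟨u, hu, hTu⟩ := ih _ hd
    -- Peel off one variable: the rest has a preimage `u` by induction, and `hmul` handles `X j`
    -- times the image of each monomial of `u`.
    have hmon : monomial c (1 : R) = X j * squareSubst f u := by
      rw [hTu, X, monomial_mul, ← hc, one_mul]
    rw [hmon, as_sum u, map_sum, Finset.mul_sum]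
    refine Submodule.sum_mem _ fun s hs => ?_
    have : monomial s (coeff s u) = coeff s u • monomial s 1 := by simp [smul_monomial]
    rw [this, map_smul, squareSubst_monomial, mul_smul_comm]
    refine Submodule.smul_mem _ _ (Submodule.map_mono (fun p hp => ?_) (hmul j s))
    simp only [SetLike.mem_coe, mem_restrictTotalDegree] at hu hp ⊢
    have := totalDegree_le_iff_degree.1 hu s (mem_support_iff.1 hs)
    omega

theorem restrictTotalDegree_le_map_squareSubst {f : σ → MvPolynomial σ R}
    (hsurj : ∀ d ≤ Fintype.card σ + 1,
      restrictTotalDegree σ R d ≤ (restrictTotalDegree σ R d).map (squareSubst f)) (d : ℕ) :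
    restrictTotalDegree σ R d ≤ (restrictTotalDegree σ R d).map (squareSubst f) := by
  intro p hp
  rw [mem_restrictTotalDegree] at hp
  rw [as_sum p]
  refine Submodule.sum_mem _ fun s hs => ?_
  have : monomial s (coeff s p) = coeff s p • monomial s 1 := by simp [smul_monomial]
  rw [this]
  refine Submodule.smul_mem _ _ (Submodule.map_mono (fun q hq => ?_)
    (monomial_mem_map_squareSubst hsurj s))
  rw [mem_restrictTotalDegree] at hq ⊢
  exact hq.trans (totalDegree_le_iff_degree.1 hp s (mem_support_iff.1 hs))

end SquareSubstitution

/-! ### From equal ideals to equal linear spans. -/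

section Ideals

variable {σ K : Type*} [Fintype σ] [Field K] {f : σ → MvPolynomial σ K}

/-- A surjective endomorphism of the finite-dimensional space of polynomials of degree at most `d`
is injective. -/
theorem squareSubst_injective (hf : ∀ i, (f i).totalDegree ≤ 2)
    (hT : ∀ d, restrictTotalDegree σ K d ≤ (restrictTotalDegree σ K d).map (squareSubst f)) :
    Function.Injective (squareSubst f) := by
  rw [injective_iff_map_eq_zero]
  intro g hg
  set d := g.totalDegree
  have hmaps : ∀ p ∈ restrictTotalDegree σ K d, squareSubst f p ∈ restrictTotalDegree σ K d := by
    intro p hp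
    rw [mem_restrictTotalDegree] at hp ⊢
    exact totalDegree_squareSubst_le hf hp
  have hs : Function.Surjective ((squareSubst f).restrict hmaps) := by
    rintro ⟨p, hp⟩
    obtain ⟨q, hq, hqp⟩ := hT d hp
    exact ⟨⟨q, hq⟩, Subtype.ext hqp⟩
  have hi := LinearMap.injective_iff_surjective.2 hs
  have hgd : g ∈ restrictTotalDegree σ K d := (mem_restrictTotalDegree _ _ _).2 le_rfl
  have : (⟨g, hgd⟩ : restrictTotalDegree σ K d) = 0 := hi (by
    rw [map_zero]; exact Subtype.ext hg)
  exact congrArg Subtype.val this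

/-- The quadratic forms by which multiplication is compatible with `squareSubst f`. -/
def compatibleForms (f : σ → MvPolynomial σ K) : Submodule K (MvPolynomial σ K) where
  carrier := {Q | Q.IsHomogeneous 2 ∧ ∀ k, squareSubst f (Q * k) = squareSubst f Q * squareSubst f k}
  add_mem' := by
    rintro P Q ⟨hP, hP'⟩ ⟨hQ, hQ'⟩
    exact ⟨hP.add hQ, fun k => by rw [add_mul, map_add, hP', hQ', map_add, add_mul]⟩
  zero_mem' := ⟨isHomogeneous_zero _ _ _, fun k => by simp⟩
  smul_mem' := by
    rintro r Q ⟨hQ, hQ'⟩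
    refine ⟨?_, fun k => by rw [smul_mul_assoc, map_smul, hQ', map_smul, smul_mul_assoc]⟩
    rw [smul_eq_C_mul]
    simpa using (isHomogeneous_C σ r).mul hQ

theorem squareSubst_sq (f : σ → MvPolynomial σ K) (j : σ) : squareSubst f (X j ^ 2) = f j := by
  have h1 : squareSubst f 1 = 1 := by
    have := squareSubst_monomial f 0
    simpa [squareFamily] using this
  simpa [h1] using squareSubst_sq_mul f j 1

theorem sq_mem_compatibleForms (j : σ) : X j ^ 2 ∈ compatibleForms f :=
  ⟨isHomogeneous_X_pow j 2, fun k => by rw [squareSubst_sq_mul, squareSubst_sq]⟩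

theorem mem_span_of_mem_ideal_of_compatibleForms {ι : Type*} [Fintype ι]
    (hT : ∀ d, restrictTotalDegree σ K d ≤ (restrictTotalDegree σ K d).map (squareSubst f))
    (hinj : Function.Injective (squareSubst f)) {G Q : ι → MvPolynomial σ K}
    (hQ : ∀ t, Q t ∈ compatibleForms f) (hGQ : ∀ t, squareSubst f (Q t) = G t)
    {g : MvPolynomial σ K} (hg : g ∈ Ideal.span (Set.range G)) (hdeg : g.totalDegree ≤ 2) :
    g ∈ Submodule.span K (Set.range G) := by
  obtain ⟨c, rfl⟩ := Ideal.mem_span_range_iff_exists_fun.1 hg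
  obtain ⟨u, hu, hTu⟩ := hT 2 ((mem_restrictTotalDegree _ _ _).2 hdeg)
  have hpre : ∀ p, ∃ k, squareSubst f k = p := fun p => by
    obtain ⟨k, -, hk⟩ := hT _ ((mem_restrictTotalDegree _ _ p).2 le_rfl)
    exact ⟨k, hk⟩
  choose k hk using fun t => hpre (c t)
  have hu1 : u = ∑ t, Q t * k t := hinj (by
    rw [hTu, map_sum]
    exact Finset.sum_congr rfl fun t _ => by rw [(hQ t).2, hGQ, hk, mul_comm])
  -- `u` has degree at most 2 because preimages respect degree, so only the constant terms of the `k
  -- t` can contribute.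
  have hu2 : u = ∑ t, coeff 0 (k t) • Q t := by
    ext s
    by_cases hs : s.degree ≤ 2
    · conv_lhs => rw [hu1]
      simp only [coeff_sum, coeff_smul, smul_eq_mul]
      exact Finset.sum_congr rfl fun t _ => coeff_mul_of_isHomogeneous (hQ t).1 hs
    · have h0 : ∀ p : MvPolynomial σ K, p.totalDegree ≤ 2 → coeff s p = 0 := fun p hp => by
        by_contra h
        exact hs (totalDegree_le_iff_degree.1 hp s h)
      rw [h0 u ((mem_restrictTotalDegree _ _ _).1 hu), coeff_sum]
      exact (Finset.sum_eq_zero fun t _ => by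
        rw [coeff_smul, h0 _ (hQ t).1.totalDegree_le, smul_zero]).symm
  rw [← hTu, hu2, map_sum]
  refine Submodule.sum_mem _ fun t _ => ?_
  rw [map_smul, hGQ]
  exact Submodule.smul_mem _ _ (Submodule.subset_span ⟨t, rfl⟩)

theorem span_eq_span_of_ideal_eq {ι κ : Type*} [Fintype ι] [Fintype κ]
    (hf : ∀ i, (f i).totalDegree ≤ 2)
    (hT : ∀ d ≤ Fintype.card σ + 1,
      restrictTotalDegree σ K d ≤ (restrictTotalDegree σ K d).map (squareSubst f))
    (e : ι → σ) {G : κ → MvPolynomial σ K} (hG : ∀ t, (G t).totalDegree ≤ 2)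
    (hGf : Ideal.span (Set.range G) = Ideal.span (Set.range (f ∘ e))) :
    Submodule.span K (Set.range G) = Submodule.span K (Set.range (f ∘ e)) := by
  replace hT := restrictTotalDegree_le_map_squareSubst hT
  have hinj := squareSubst_injective hf hT
  have h1 : ∀ t, G t ∈ Submodule.span K (Set.range (f ∘ e)) := fun t =>
    mem_span_of_mem_ideal_of_compatibleForms hT hinj
      (fun i => sq_mem_compatibleForms (e i)) (fun i => squareSubst_sq f (e i))
      (hGf ▸ Ideal.subset_span ⟨t, rfl⟩) (hG t)
  have hle : Submodule.span K (Set.range (f ∘ e)) ≤ (compatibleForms f).map (squareSubst f) := by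
    rw [Submodule.span_le]
    rintro _ ⟨i, rfl⟩
    exact ⟨_, sq_mem_compatibleForms (e i), squareSubst_sq f (e i)⟩
  -- The first inclusion makes each `G t` the image of a compatible form, so the same argument runs
  -- with `G` as generators.
  choose Q hQ hGQ using fun t => hle (h1 t)
  refine le_antisymm (Submodule.span_le.2 ?_) (Submodule.span_le.2 ?_)
  · rintro _ ⟨t, rfl⟩
    exact h1 t
  · rintro _ ⟨i, rfl⟩
    exact mem_span_of_mem_ideal_of_compatibleForms hT hinj hQ hGQ
      (hGf ▸ Ideal.subset_span ⟨i, rfl⟩) (hf _)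

end Ideals

/-! ### Bijectivity as a nonvanishing determinant. -/

section CoefficientMatrix

variable {σ : Type*} [Finite σ]

instance fintypeDegreeLE (d : ℕ) : Fintype {c : σ →₀ ℕ // c.degree ≤ d} :=
  haveI : Finite {c : σ →₀ ℕ // c.degree ≤ d} := (Finsupp.finite_of_degree_le d).to_subtype
  Fintype.ofFinite _

/-- The determinant of the matrix of coefficients, in degrees at most `d`, of a family of
polynomials indexed by the monomials of degree at most `d`. -/
def coeffDet {R : Type*} [CommRing R] (d : ℕ) (w : (σ →₀ ℕ) → MvPolynomial σ R) : R :=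
  by
    classical
    exact (Matrix.of fun c c' : {c : σ →₀ ℕ // c.degree ≤ d} => coeff c'.1 (w c.1)).det

theorem map_coeffDet {R S : Type*} [CommRing R] [CommRing S] (φ : R →+* S) (d : ℕ)
    (w : (σ →₀ ℕ) → MvPolynomial σ R) :
    φ (coeffDet d w) = coeffDet d fun c => map φ (w c) := by
  simp only [coeffDet, RingHom.map_det]
  congr 1

theorem coeffDet_monomial {R : Type*} [CommRing R] (d : ℕ) :
    coeffDet d (fun c : σ →₀ ℕ => monomial c (1 : R)) = 1 := by
  classical
  simp only [coeffDet]
  convert Matrix.det_one (R := R) (n := {c : σ →₀ ℕ // c.degree ≤ d})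
  ext c c'
  simp [coeff_monomial, Matrix.one_apply, Subtype.ext_iff]

theorem exists_eq_sum_of_coeffDet_ne_zero {K : Type*} [Field K] {d : ℕ}
    {w : (σ →₀ ℕ) → MvPolynomial σ K}
    (hw : ∀ c : σ →₀ ℕ, c.degree ≤ d → (w c).totalDegree ≤ d) (hdet : coeffDet d w ≠ 0)
    {g : MvPolynomial σ K} (hg : g.totalDegree ≤ d) :
    ∃ u : {c : σ →₀ ℕ // c.degree ≤ d} → K, g = ∑ c, u c • w c.1 := by
  classical
  set M := Matrix.of fun c c' : {c : σ →₀ ℕ // c.degree ≤ d} => coeff c'.1 (w c.1) with hM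
  have hunit : IsUnit M.det := by
    rw [isUnit_iff_ne_zero]
    convert hdet using 1
    simp only [coeffDet, hM]
  set v : {c : σ →₀ ℕ // c.degree ≤ d} → K := fun c => coeff c.1 g
  refine ⟨Matrix.vecMul v M⁻¹, ?_⟩
  have hv : Matrix.vecMul (Matrix.vecMul v M⁻¹) M = v := by
    rw [Matrix.vecMul_vecMul, Matrix.nonsing_inv_mul _ hunit, Matrix.vecMul_one]
  ext s
  by_cases hs : s.degree ≤ d
  · have := congrFun hv ⟨s, hs⟩
    simp only [Matrix.vecMul, dotProduct, hM, Matrix.of_apply] at this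
    simp only [coeff_sum, coeff_smul, smul_eq_mul]
    exact this.symm
  · have h0 : ∀ p : MvPolynomial σ K, p.totalDegree ≤ d → coeff s p = 0 := fun p hp => by
      by_contra h
      exact hs (totalDegree_le_iff_degree.1 hp s h)
    rw [h0 g hg, coeff_sum]
    exact (Finset.sum_eq_zero fun c _ => by rw [coeff_smul, h0 _ (hw c.1 c.2), smul_zero]).symm

theorem restrictTotalDegree_le_map_of_coeffDet_ne_zero {σ K : Type*} [Fintype σ] [Field K]
    {f : σ → MvPolynomial σ K} (hf : ∀ i, (f i).totalDegree ≤ 2) {d : ℕ}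
    (hdet : coeffDet d (squareFamily f) ≠ 0) :
    restrictTotalDegree σ K d ≤ (restrictTotalDegree σ K d).map (squareSubst f) := by
  intro g hg
  obtain ⟨u, rfl⟩ := exists_eq_sum_of_coeffDet_ne_zero
    (fun c hc => (totalDegree_squareFamily_le hf c).trans hc) hdet
    ((mem_restrictTotalDegree _ _ _).1 hg)
  refine Submodule.sum_mem _ fun c _ => Submodule.smul_mem _ _ ⟨monomial c.1 1, ?_, ?_⟩
  · exact (mem_restrictTotalDegree _ _ _).2 ((totalDegree_monomial_le_degree _ _).trans c.2)
  · exact squareSubst_monomial f c.1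

end CoefficientMatrix

/-! ### Generic coefficients, Macaulay matrices and density. -/

section Genericity

/-- The list of polynomials of degree at most two with indeterminate coefficients. -/
def genericList (n m : ℕ) (i : Fin m) :
    MvPolynomial (Fin n) (MvPolynomial (Fin m × QuadExponent n) ℝ) :=
  ∑ s : QuadExponent n, monomial s.1 (X (i, s))

theorem map_genericList {n m : ℕ} {F : Fin m → MvPolynomial (Fin n) ℝ} {i : Fin m}
    (hF : (F i).totalDegree ≤ 2) : map (eval (coeffVector F)) (genericList n m i) = F i := by
  classical
  ext s
  simp only [genericList, map_sum, map_monomial, eval_X, coeff_sum, coeff_monomial, coeffVector]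
  by_cases hs : s.degree ≤ 2
  · rw [Finset.sum_eq_single ⟨s, hs⟩] <;> simp +contextual [Subtype.ext_iff]
  · rw [Finset.sum_eq_zero fun t _ => if_neg fun h : t.1 = s => hs (h ▸ t.2)]
    by_contra h
    exact hs (totalDegree_le_iff_degree.1 hF s (Ne.symm h))

/-- A list of at most `n` polynomials in `n` variables extended by squares of variables. -/
def extendBySquares {n m : ℕ} {R : Type*} [CommRing R] (F : Fin m → MvPolynomial (Fin n) R)
    (j : Fin n) : MvPolynomial (Fin n) R :=
  if h : j.1 < m then F ⟨j, h⟩ else X j ^ 2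

theorem map_extendBySquares {n m : ℕ} {R S : Type*} [CommRing R] [CommRing S] (φ : R →+* S)
    (F : Fin m → MvPolynomial (Fin n) R) (j : Fin n) :
    map φ (extendBySquares F j) = extendBySquares (fun i => map φ (F i)) j := by
  unfold extendBySquares
  split_ifs <;> simp

theorem totalDegree_extendBySquares_le {n m : ℕ} {R : Type*} [CommRing R]
    {F : Fin m → MvPolynomial (Fin n) R} (hF : ∀ i, (F i).totalDegree ≤ 2) (j : Fin n) :
    (extendBySquares F j).totalDegree ≤ 2 := by
  unfold extendBySquares
  split_ifs
  · exact hF _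
  · exact (isHomogeneous_X_pow j 2).totalDegree_le

open Classical in
/-- A family whose span contains `1` only if the first `n + 1` polynomials generate the unit ideal:
each monomial is replaced by a multiple of one of these polynomials. -/
def macaulayFamily {n m : ℕ} (hnm : n < m) {R : Type*} [CommRing R]
    (F : Fin m → MvPolynomial (Fin n) R) (c : Fin n →₀ ℕ) : MvPolynomial (Fin n) R :=
  if h : ∃ i, 2 ≤ c i then
    monomial (c - Finsupp.single h.choose 2) 1 * F (h.choose.castLE hnm.le)
  else monomial c 1 * F ⟨n, hnm⟩

theorem map_macaulayFamily {n m : ℕ} (hnm : n < m) {R S : Type*} [CommRing R] [CommRing S]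
    (φ : R →+* S) (F : Fin m → MvPolynomial (Fin n) R) (c : Fin n →₀ ℕ) :
    map φ (macaulayFamily hnm F c) = macaulayFamily hnm (fun i => map φ (F i)) c := by
  unfold macaulayFamily
  split_ifs <;> simp

theorem sub_single_add {n : ℕ} {c : Fin n →₀ ℕ} {i : Fin n} (h : 2 ≤ c i) :
    c - Finsupp.single i 2 + Finsupp.single i 2 = c :=
  tsub_add_cancel_of_le (Finsupp.single_le_iff.2 h)

theorem totalDegree_macaulayFamily_le {n m : ℕ} (hnm : n < m) {R : Type*} [CommRing R]
    {F : Fin m → MvPolynomial (Fin n) R} (hF : ∀ i, (F i).totalDegree ≤ 2) {c : Fin n →₀ ℕ}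
    (hc : c.degree ≤ n + 2) : (macaulayFamily hnm F c).totalDegree ≤ n + 2 := by
  unfold macaulayFamily
  split_ifs with h
  · refine (totalDegree_mul _ _).trans ?_
    have h1 := totalDegree_monomial_le_degree (c - Finsupp.single h.choose 2) (1 : R)
    have h2 := congrArg Finsupp.degree (sub_single_add h.choose_spec)
    rw [map_add, Finsupp.degree_single] at h2
    have := hF (h.choose.castLE hnm.le)
    omega
  · refine (totalDegree_mul _ _).trans ?_
    have h1 := totalDegree_monomial_le_degree c (1 : R)
    -- Here `c` is squarefree, so a quadratic multiple of its monomial has degree at most `n + 2`;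
    -- this fixes the degree of the Macaulay matrix.
    have h2 : c.degree ≤ n := by
      rw [Finsupp.degree_eq_sum]
      push Not at h
      calc ∑ i, c i ≤ ∑ _i : Fin n, 1 := Finset.sum_le_sum fun i _ => Nat.le_of_lt_succ (h i)
        _ = n := by simp
    have := hF ⟨n, hnm⟩
    omega

theorem macaulayFamily_sq {n m : ℕ} (hnm : n < m) (c : Fin n →₀ ℕ) :
    macaulayFamily hnm (fun i : Fin m => if h : i.1 < n then
      (X ⟨i, h⟩ : MvPolynomial (Fin n) ℝ) ^ 2 else 1) c = monomial c 1 := by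
  unfold macaulayFamily
  split_ifs with h
  · simp [X_pow_eq_monomial, monomial_mul, sub_single_add h.choose_spec]
  · simp

theorem eval_macaulayFamily {n m : ℕ} (hnm : n < m) {F : Fin m → MvPolynomial (Fin n) ℝ}
    {x : Fin n → ℝ} (hx : x ∈ realVariety F) (c : Fin n →₀ ℕ) :
    eval x (macaulayFamily hnm F c) = 0 := by
  unfold macaulayFamily
  split_ifs <;> rw [map_mul, hx, mul_zero]

/-- The constant 1 is a combination of multiples of the `F i`, which all vanish at a common zero. -/
theorem realVariety_eq_empty_of_coeffDet_ne_zero {n m : ℕ} (hnm : n < m)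
    {F : Fin m → MvPolynomial (Fin n) ℝ} (hF : ∀ i, (F i).totalDegree ≤ 2)
    (hdet : coeffDet (n + 2) (macaulayFamily hnm F) ≠ 0) : realVariety F = ∅ := by
  rw [Set.eq_empty_iff_forall_notMem]
  intro x hx
  obtain ⟨u, hu⟩ := exists_eq_sum_of_coeffDet_ne_zero
    (fun c hc => totalDegree_macaulayFamily_le hnm hF hc) hdet
    (g := 1) (by simp)
  have := congrArg (eval x) hu
  simp [eval_macaulayFamily hnm hx, smul_eval] at this

theorem isZariskiOpen_ne_zero {ι : Type*} (P : MvPolynomial ι ℝ) :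
    IsZariskiOpen {y | eval y P ≠ 0} := by
  refine ⟨Ideal.span {P}, ?_⟩
  ext y
  simp [zeroLocus_span, MvPolynomial.aeval_eq_eval]

theorem dense_ne_zero {ι : Type*} {P : MvPolynomial ι ℝ} {y : ι → ℝ} (hy : eval y P ≠ 0) :
    Dense {z | eval z P ≠ 0} := by
  intro x
  -- Restrict `P` to the line from `x` to `y`: it is nonzero at `t = 1`, so it has finitely many
  -- roots and `x` is a limit of nonzeros.
  let L : ι → Polynomial ℝ := fun i => Polynomial.C (x i) + Polynomial.X * Polynomial.C (y i - x i)
  set q : Polynomial ℝ := aeval L P with hq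
  have heval : ∀ t : ℝ, q.eval t = eval (fun i => x i + t * (y i - x i)) P := by
    intro t
    have : ((Polynomial.aeval t).comp (aeval L : MvPolynomial ι ℝ →ₐ[ℝ] _)) P =
        aeval (fun i => x i + t * (y i - x i)) P := by
      congr 1
      ext i
      simp [L]
    simpa [hq, Polynomial.aeval_def, MvPolynomial.aeval_eq_eval] using this
  have hq0 : q ≠ 0 := by
    intro h
    apply hy
    have := heval 1
    rw [h] at this
    simpa using this.symm
  have hdense : Dense {t : ℝ | q.eval t ≠ 0} := by
    have := (Polynomial.finite_setOfPred_isRoot hq0 : Set.Finite _).countable.dense_compl ℝ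
    exact this
  have hcont : Continuous fun (t : ℝ) (i : ι) => x i + t * (y i - x i) := by fun_prop
  have h0 := hcont.range_subset_closure_image_dense hdense ⟨0, rfl⟩
  simp only [zero_mul, add_zero] at h0
  refine closure_mono ?_ h0
  rintro _ ⟨t, ht, rfl⟩
  simpa only [Set.mem_ofPred_eq, ← heval] using ht

end Genericity

/-! ### Dependence of the exact region on span and variety. -/

section ExactRegion

theorem quadMatrix_sum {n : ℕ} {ι : Type*} (s : Finset ι) (μ : ι → ℝ)
    (F : ι → MvPolynomial (Fin n) ℝ) :
    quadMatrix (∑ i ∈ s, μ i • F i) = ∑ i ∈ s, μ i • quadMatrix (F i) := by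
  ext j k
  simp only [quadMatrix, Matrix.of_apply, Matrix.sum_apply, Matrix.smul_apply, smul_eq_mul]
  split_ifs
  · simp [coeff_sum]
  · simp [coeff_sum, Finset.sum_div, mul_div_assoc]

theorem linVector_sum {n : ℕ} {ι : Type*} (s : Finset ι) (μ : ι → ℝ)
    (F : ι → MvPolynomial (Fin n) ℝ) :
    linVector (∑ i ∈ s, μ i • F i) = ∑ i ∈ s, μ i • linVector (F i) := by
  ext j
  simp [linVector, coeff_sum, Finset.sum_div, mul_div_assoc]

theorem exactRegion_subset {n m N : ℕ} {F : Fin m → MvPolynomial (Fin n) ℝ}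
    {G : Fin N → MvPolynomial (Fin n) ℝ} (hV : realVariety F ⊆ realVariety G)
    (hspan : Submodule.span ℝ (Set.range F) ≤ Submodule.span ℝ (Set.range G)) :
    exactRegion F ⊆ exactRegion G := by
  rintro p ⟨hp, x, hx, μ, hpos, heq⟩
  have hmem : ∑ i, μ i • F i ∈ Submodule.span ℝ (Set.range G) :=
    hspan (Submodule.sum_mem _ fun i _ => Submodule.smul_mem _ _ (Submodule.subset_span ⟨i, rfl⟩))
  obtain ⟨ν, hν⟩ := (Submodule.mem_span_range_iff_exists_fun ℝ).1 hmem
  have hquad := congrArg quadMatrix hν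
  have hlin := congrArg linVector hν
  rw [quadMatrix_sum, quadMatrix_sum] at hquad
  rw [linVector_sum, linVector_sum] at hlin
  have hH : hessian G p.1 ν = hessian F p.1 μ := by rw [hessian, hessian, hquad]
  exact ⟨hp, x, hV hx, ν, hH ▸ hpos, by rw [hH, hlin]; exact heq⟩

theorem realVariety_subset {n m N : ℕ} {F : Fin m → MvPolynomial (Fin n) ℝ}
    {G : Fin N → MvPolynomial (Fin n) ℝ} (h : idealOf G ≤ idealOf F) :
    realVariety F ⊆ realVariety G := by
  intro x hx t
  have hle : idealOf F ≤ RingHom.ker (eval x) := by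
    rw [idealOf, Ideal.span_le]
    rintro _ ⟨i, rfl⟩
    exact hx i
  exact hle (h (Ideal.subset_span ⟨t, rfl⟩))

theorem exactRegion_eq_empty {n m : ℕ} {F : Fin m → MvPolynomial (Fin n) ℝ}
    (h : realVariety F = ∅) : exactRegion F = ∅ := by
  rw [Set.eq_empty_iff_forall_notMem]
  rintro p ⟨-, x, hx, -⟩
  simp [h] at hx

theorem invariantUnderGenerators_of_realVariety_eq_empty {n m : ℕ}
    {F : Fin m → MvPolynomial (Fin n) ℝ} (h : realVariety F = ∅) :
    InvariantUnderGenerators F := by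
  intro N G _ hGF
  have hG : realVariety G = ∅ := Set.subset_eq_empty (realVariety_subset hGF.ge) h
  rw [exactRegion_eq_empty h, exactRegion_eq_empty hG]

theorem invariantUnderGenerators_of_coeffDet_ne_zero {n m : ℕ} (hmn : m ≤ n)
    {F : Fin m → MvPolynomial (Fin n) ℝ} (hF : ∀ i, (F i).totalDegree ≤ 2)
    (hdet : ∀ d ≤ n + 1, coeffDet d (squareFamily (extendBySquares F)) ≠ 0) :
    InvariantUnderGenerators F := by
  intro N G hG hGF
  have hFe : extendBySquares F ∘ Fin.castLE hmn = F := by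
    ext1 i
    simp [extendBySquares]
  have hspan := span_eq_span_of_ideal_eq (totalDegree_extendBySquares_le hF)
    (fun d hd => restrictTotalDegree_le_map_of_coeffDet_ne_zero
      (totalDegree_extendBySquares_le hF) (hdet d (by simpa using hd)))
    (Fin.castLE hmn) hG (by rw [hFe]; exact hGF)
  rw [hFe] at hspan
  exact (exactRegion_subset (realVariety_subset hGF.ge) hspan.le).antisymm
    (exactRegion_subset (realVariety_subset hGF.le) hspan.ge)

end ExactRegion

end ShorSDP

end

/-! ### The generic set in the cases `m ≤ n` and `m > n`. -/

theorem mainTheorem9 (n m : ℕ) :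
    ∃ U : Set (Fin m × ShorSDP.QuadExponent n → ℝ),
      ShorSDP.IsZariskiOpen U ∧ Dense U ∧
        ∀ F : Fin m → MvPolynomial (Fin n) ℝ,
          (∀ i, (F i).totalDegree = 2) →
          (∀ i, ShorSDP.FullMonomialSupport (F i)) →
          ShorSDP.coeffVector F ∈ U →
          ShorSDP.InvariantUnderGenerators F := by
  open ShorSDP in
  rcases le_or_gt m n with hmn | hnm
  · obtain ⟨P, key⟩ : ∃ P, ∀ F : Fin m → MvPolynomial (Fin n) ℝ, (∀ i, (F i).totalDegree ≤ 2) →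
        eval (coeffVector F) P =
          ∏ d ∈ Finset.range (n + 2), coeffDet d (squareFamily (extendBySquares F)) := by
      refine ⟨∏ d ∈ Finset.range (n + 2),
        coeffDet d (squareFamily (extendBySquares (genericList n m))), fun F hF => ?_⟩
      rw [map_prod]
      refine Finset.prod_congr rfl fun d _ => ?_
      rw [map_coeffDet]
      simp_rw [map_squareFamily, map_extendBySquares, map_genericList (hF _)]
    -- At the squares of the first `m` variables the padded list is all squares, the substitution is
    -- the identity and every determinant is 1.
    refine ⟨_, isZariskiOpen_ne_zero P, dense_ne_zero (y := coeffVector fun i : Fin m =>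
      X (Fin.castLE hmn i) ^ 2) ?_, fun F hF _ hU => ?_⟩
    · rw [key _ fun i => (isHomogeneous_X_pow _ 2).totalDegree_le]
      refine Finset.prod_ne_zero_iff.2 fun d _ => ?_
      have : extendBySquares (fun i : Fin m => (X (Fin.castLE hmn i) : MvPolynomial (Fin n) ℝ) ^ 2)
          = fun i => X i ^ 2 := by
        ext1 j
        simp [extendBySquares]
      rw [this, funext squareFamily_sq, coeffDet_monomial]
      exact one_ne_zero
    · rw [Set.mem_ofPred_eq, key F fun i => (hF i).le, Finset.prod_ne_zero_iff] at hU
      exact invariantUnderGenerators_of_coeffDet_ne_zero hmn (fun i => (hF i).le)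
        fun d hd => hU d (Finset.mem_range.2 (by omega))
  · obtain ⟨P, key⟩ : ∃ P, ∀ F : Fin m → MvPolynomial (Fin n) ℝ, (∀ i, (F i).totalDegree ≤ 2) →
        eval (coeffVector F) P = coeffDet (n + 2) (macaulayFamily hnm F) := by
      refine ⟨coeffDet (n + 2) (macaulayFamily hnm (genericList n m)), fun F hF => ?_⟩
      rw [map_coeffDet]
      simp_rw [map_macaulayFamily, map_genericList (hF _)]
    -- For the `n` squares followed by constants 1, the Macaulay family is the monomial basis
    -- itself.
    refine ⟨_, isZariskiOpen_ne_zero P, dense_ne_zero (y := coeffVector fun i : Fin m =>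
      if h : i.1 < n then X ⟨i, h⟩ ^ 2 else 1) ?_, fun F hF _ hU => ?_⟩
    · rw [key, funext (macaulayFamily_sq hnm), coeffDet_monomial]
      · exact one_ne_zero
      · intro i
        split_ifs
        · exact (isHomogeneous_X_pow _ 2).totalDegree_le
        · simp
    · rw [Set.mem_ofPred_eq, key F fun i => (hF i).le] at hU
      exact invariantUnderGenerators_of_realVariety_eq_empty
        (realVariety_eq_empty_of_coeffDet_ne_zero hnm (fun i => (hF i).le) hU)
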